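/- Let $K=[a_1,a_2]\cup[a_3,a_4]\cup\dots\cup[a_{2\ell-1},a_{2\ell}]$ with $\ell\ge 1$ and real numbers $a_1<a_2<\dots<a_{2\ell}$. Let $g=g(\cdot\,;K^c)$ be the Green's function of $K^c:=(\mathbb{C}\cup\{\infty\})\setminus K$ with pole at infinity, i.e. the function with the following three properties: $g$ is harmonic in $\mathbb{C}\setminus K$; $g(z)-\log|z|$ is harmonic in a neighbourhood of infinity (including $\infty$); and $g(z)\to 0$ as $z\to K$, $z\notin K$. For a polynomial $Q$ put $\|Q\|_K:=\max_{z\in K}|Q(z)|$ and $Q^{-1}([-1,1]):=\{z\in\mathbb{C}:Q(z)\in[-1,1]\}$. Then for every polynomial $Q_n$ of (exact) degree $n\ge 0$ with complex coefficients and every $x\in\mathbb{R}\setminus K$, $$\frac{|Q_n(x)|}{\|Q_n\|_K}\le\frac12\Bigl(\exp\bigl(n\,g(x;K^c)\bigr)+\exp\bigl(-n\,g(x;K^c)\bigr)\Bigr)=\cosh\bigl(n\,g(x;K^c)\bigr).$$ Moreover, if $n\ge 1$, then for each $x\in\mathbb{R}\setminus K$ equality holds at $x$ if and only if, up to a nonzero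 constant factor, $Q_n$ has $K$ as its inverse image of $[-1,1]$, i.e. there is $c\in\mathbb{C}\setminus\{0\}$ with $(c\,Q_n)^{-1}([-1,1])=K$. -/

import Mathlib

/-- The union `[a₁, a₂] ∪ [a₃, a₄] ∪ ⋯ ∪ [a_{2ℓ-1}, a_{2ℓ}]` of `ℓ` real intervals (the end points
are indexed from `0`). -/
def intervalUnion {ℓ : ℕ} (a : Fin (2 * ℓ) → ℝ) : Set ℝ :=
  ⋃ j : Fin ℓ, Set.Icc (a ⟨2 * j.val, by omega⟩) (a ⟨2 * j.val + 1, by omega⟩)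

/-- `g` is the Green's function of the complement of `S` in the Riemann sphere, with pole at
infinity. Only the values of `g` outside `S` matter. Harmonicity of `g(z) - log |z|` in a
neighbourhood of infinity is expressed in the chart `w = 1/z` at infinity. -/
structure IsGreenFunction (S : Set ℂ) (g : ℂ → ℝ) : Prop where
  harmonic : InnerProductSpace.HarmonicOnNhd g Sᶜ
  harmonic_at_infinity : ∃ h : ℂ → ℝ, InnerProductSpace.HarmonicAt h 0 ∧
    ∀ᶠ z in Bornology.cobounded ℂ, g z - Real.log ‖z‖ = h z⁻¹
  tendsto_zero : ∀ ζ ∈ S, Filter.Tendsto g (nhdsWithin ζ Sᶜ) (nhds 0)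

/-- The supremum norm of a polynomial on `S`. -/
noncomputable def polySupNorm (S : Set ℂ) (Q : Polynomial ℂ) : ℝ :=
  sSup ((fun z : ℂ => ‖Q.eval z‖) '' S)

/-- The inverse image of `[-1, 1]` under the polynomial mapping `Q` of the complex plane. -/
def inversePolyImage (Q : Polynomial ℂ) : Set ℂ :=
  {z : ℂ | ∃ t ∈ Set.Icc (-1 : ℝ) 1, Q.eval z = (t : ℂ)}

/-! The function J = `joukowskyLog` is the Green's function of the complement of [-1, 1]. Normalise
Q to P with norm 1 on K, rotate it by a unimodular u so that uP(x) = |P(x)|, and let R be the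
polynomial that equals Re(uP) on the real line. R maps K into [-1, 1], so J∘R vanishes on K and
grows at most like n log|z|. The minimum principle gives J∘R ≤ n g off K (`joukowskyLog_eval_le`),
and taking cosh at x gives the bound. If equality holds at x, then n g - J∘R is nonnegative with a
zero; it is harmonic at each of its zeros, because J∘R = n g > 0 there. As the complement of K is
connected, J∘R = n g throughout, so the inverse image of [-1, 1] under R is K. Applying the bound at
every real point off K then shows uP real there, whence R = uP. Conversely, if that inverse image
under P is K, the comparison works in both directions (`le_joukowskyLog_eval`). -/

section

open InnerProductSpace Filter Topology Set Bornology

/-! ### Minimum principles. -/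

/-- A harmonic function on the plane is locally constant near a local minimum. -/
theorem harmonicAt_eventually_eq_of_isLocalMin {v : ℂ → ℝ} {z : ℂ} (hv : HarmonicAt v z)
    (hmin : IsLocalMin v z) : ∀ᶠ y in 𝓝 z, v y = v z := by
  obtain ⟨r, hr, hball⟩ := Metric.eventually_nhds_iff_ball.1 hv.eventually
  obtain ⟨F, hF, hFv⟩ := HarmonicOnNhd.exists_analyticOnNhd_ball_re_eq (f := v) (z := z) (R := r)
    hball
  -- With v = Re F, a minimum of v is a maximum of |exp(-F)|, so the maximum modulus principle
  -- applies.
  have hnorm : ∀ᶠ y in 𝓝 z, ‖Complex.exp (-F y)‖ = Real.exp (-v y) := by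
    filter_upwards [Metric.ball_mem_nhds z hr] with y hy
    rw [Complex.norm_exp, Complex.neg_re, ← hFv hy]
  have hz := hnorm.self_of_nhds
  have hd : ∀ᶠ y in 𝓝 z, DifferentiableAt ℂ (fun y => Complex.exp (-F y)) y := by
    filter_upwards [Metric.ball_mem_nhds z hr] with y hy
    exact (hF y hy).differentiableAt.neg.cexp
  have hmax : IsLocalMax (norm ∘ fun y => Complex.exp (-F y)) z := by
    filter_upwards [hnorm, hmin] with y hy hy'
    simp only [Function.comp_apply, hy, hz]
    gcongr
  filter_upwards [Complex.norm_eventually_eq_of_isLocalMax hd hmax, hnorm] with y hy hy'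
  rw [hy', hz] at hy
  linarith [Real.exp_injective hy]

/-- Minimum principle on an open subset of the plane, for a harmonic function that tends to `+∞` at
infinity and is asymptotically nonnegative at the boundary. -/
theorem nonneg_of_harmonicOnNhd_compl {S : Set ℂ} {v : ℂ → ℝ} (hS : IsClosed S)
    (hv : HarmonicOnNhd v Sᶜ)
    (hbd : ∀ ζ ∈ S, ∀ c < 0, ∀ᶠ z in 𝓝[Sᶜ] ζ, c < v z) (hinf : Tendsto v (cobounded ℂ) atTop)
    {z : ℂ} (hz : z ∉ S) : 0 ≤ v z := by
  by_contra! hneg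
  -- Below the negative level v z, points can accumulate neither at S nor at infinity.
  have hcompact : ∀ T : Set ℝ, IsClosed T → T ⊆ Iic (v z) → IsCompact (Sᶜ ∩ v ⁻¹' T) := by
    intro T hT hTz
    refine Metric.isCompact_of_isClosed_isBounded ?_ ?_
    · refine isClosed_iff_frequently.2 fun ζ hζ => ?_
      by_cases hζS : ζ ∈ S
      · have h1 := eventually_nhdsWithin_iff.1 (hbd ζ hζS _ hneg)
        obtain ⟨y, ⟨hyS, hyT⟩, hy⟩ := (hζ.and_eventually h1).exists
        exact absurd (hTz hyT) (not_le.2 (hy hyS))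
      · refine ⟨hζS, ?_⟩
        have hc : Tendsto v (𝓝 ζ) (𝓝 (v ζ)) := (hv ζ hζS).1.continuousAt
        exact hT.mem_of_frequently_of_tendsto (hζ.mono fun y hy => hy.2) hc
    · have h := hinf.eventually_gt_atTop (v z)
      have : {y | v z < v y}ᶜ ⊇ Sᶜ ∩ v ⁻¹' T := fun y hy => not_lt.2 (mem_Iic.1 (hTz hy.2))
      exact (isBounded_def.2 (by rw [compl_compl]; exact h)).subset this
  obtain ⟨w, hw, hwmin⟩ := (hcompact (Iic (v z)) isClosed_Iic subset_rfl).exists_isMinOn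
    ⟨z, hz, le_refl (v z)⟩
    (hv.continuousOn.mono inter_subset_left)
  have hglob : ∀ y ∉ S, v w ≤ v y := by
    intro y hy
    by_cases h : v y ≤ v z
    · exact hwmin ⟨hy, h⟩
    · exact le_trans hw.2 (not_le.1 h).le
  have hcl := hcompact {v w} isClosed_singleton (by simpa using hw.2)
  -- The set of minimisers is compact, open and nonempty, hence would be the whole plane.
  have hop : IsOpen (Sᶜ ∩ v ⁻¹' {v w}) := by
    refine isOpen_iff_mem_nhds.2 fun y ⟨hyS, hyv⟩ => ?_
    have hyS' := hS.isOpen_compl.mem_nhds hyS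
    have hmin : IsLocalMin v y := by
      filter_upwards [hyS'] with u hu
      rw [show v y = v w from hyv]
      exact hglob u hu
    filter_upwards [hyS', harmonicAt_eventually_eq_of_isLocalMin (hv y hyS) hmin] with u hu hu'
    exact ⟨hu, hu'.trans hyv⟩
  have huniv := IsClopen.eq_univ ⟨hcl.isClosed, hop⟩ ⟨w, hw.1, rfl⟩
  rw [huniv] at hcl
  exact noncompact_univ ℂ hcl

/-- A nonnegative continuous function on a connected open subset of the plane that is harmonic at
its zeros vanishes identically as soon as it vanishes at one point. -/
theorem eq_zero_of_nonneg_of_harmonicAt_zeros {U : Set ℂ} {v : ℂ → ℝ} (hU : IsOpen U)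
    (hconn : IsPreconnected U) (hcont : ContinuousOn v U) (hnonneg : ∀ z ∈ U, 0 ≤ v z)
    (hharm : ∀ z ∈ U, v z = 0 → HarmonicAt v z) {z₀ : ℂ} (hz₀ : z₀ ∈ U) (hv₀ : v z₀ = 0) {z : ℂ}
    (hz : z ∈ U) : v z = 0 := by
  have hop : IsOpen (U ∩ v ⁻¹' {0}) := by
    refine isOpen_iff_mem_nhds.2 fun y ⟨hyU, hyv⟩ => ?_
    have hyU' := hU.mem_nhds hyU
    have hyv : v y = 0 := hyv
    have hmin : IsLocalMin v y := by
      filter_upwards [hyU'] with u hu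
      rw [hyv]
      exact hnonneg u hu
    filter_upwards [hyU', harmonicAt_eventually_eq_of_isLocalMin (hharm y hyU hyv) hmin]
      with u hu hu'
    exact ⟨hu, hu'.trans hyv⟩
  refine (hconn.subset_of_closure_inter_subset hop ⟨z₀, hz₀, hz₀, hv₀⟩ ?_ hz).2
  rintro y ⟨hy, hyU⟩
  have hc : Tendsto v (𝓝 y) (𝓝 (v y)) := hcont.continuousAt (hU.mem_nhds hyU)
  exact ⟨hyU, isClosed_singleton.mem_of_frequently_of_tendsto
    ((mem_closure_iff_frequently.1 hy).mono fun u hu => hu.2) hc⟩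

/-! ### The Green's function of the complement of [-1, 1]. -/

/-- The Joukowsky parameter `log |w + √(w² - 1)|` of a complex number `w`: the Green's function of
the complement of `[-1, 1]`. -/
noncomputable def joukowskyLog (w : ℂ) : ℝ := Real.arcosh ((‖w - 1‖ + ‖w + 1‖) / 2)

theorem one_le_norm_sub_one_add_norm_add_one (w : ℂ) : 1 ≤ (‖w - 1‖ + ‖w + 1‖) / 2 := by
  have h := norm_sub_le (w + 1) (w - 1)
  have h2 : w + 1 - (w - 1) = 2 := by ring
  rw [h2, Complex.norm_ofNat] at h
  linarith

theorem cosh_joukowskyLog (w : ℂ) : Real.cosh (joukowskyLog w) = (‖w - 1‖ + ‖w + 1‖) / 2 :=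
  Real.cosh_arcosh (one_le_norm_sub_one_add_norm_add_one w)

theorem joukowskyLog_nonneg (w : ℂ) : 0 ≤ joukowskyLog w :=
  Real.arcosh_nonneg (one_le_norm_sub_one_add_norm_add_one w)

theorem continuous_joukowskyLog : Continuous joukowskyLog :=
  Real.continuousOn_arcosh.comp_continuous (by fun_prop) one_le_norm_sub_one_add_norm_add_one

theorem joukowskyLog_ofReal {t : ℝ} (ht : t ∈ Icc (-1) 1) : joukowskyLog (t : ℂ) = 0 := by
  have h1 : ‖(t : ℂ) - 1‖ = 1 - t := by
    rw [← Complex.ofReal_one, ← Complex.ofReal_sub, Complex.norm_real, Real.norm_eq_abs,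
      abs_sub_comm, abs_of_nonneg (by linarith [ht.2])]
  have h2 : ‖(t : ℂ) + 1‖ = 1 + t := by
    rw [← Complex.ofReal_one, ← Complex.ofReal_add, Complex.norm_real, Real.norm_eq_abs,
      abs_of_nonneg (by linarith [ht.1]), add_comm]
  rw [joukowskyLog, h1, h2]
  norm_num

theorem exists_ofReal_of_joukowskyLog_eq_zero {w : ℂ} (h : joukowskyLog w = 0) :
    ∃ t ∈ Icc (-1 : ℝ) 1, w = (t : ℂ) := by
  have hc := cosh_joukowskyLog w
  rw [h, Real.cosh_zero] at hc
  have h1 : ‖w - 1‖ = 2 - ‖w + 1‖ := by linarith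
  have h2 : ‖w - 1‖ ^ 2 = (w.re - 1) ^ 2 + w.im ^ 2 := by
    rw [← Complex.normSq_eq_norm_sq, Complex.normSq_apply]
    simp
    ring
  have h3 : ‖w + 1‖ ^ 2 = (w.re + 1) ^ 2 + w.im ^ 2 := by
    rw [← Complex.normSq_eq_norm_sq, Complex.normSq_apply]
    simp
    ring
  have h4 : ‖w + 1‖ = 1 + w.re := by rw [h1] at h2; linarith
  have h5 : ‖w - 1‖ = 1 - w.re := by linarith
  have h6 : w.im = 0 := by
    rw [h4] at h3
    have : w.im ^ 2 = 0 := by linarith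
    simpa using this
  refine ⟨w.re, ⟨by linarith [norm_nonneg (w + 1)], by linarith [norm_nonneg (w - 1)]⟩, ?_⟩
  apply Complex.ext <;> simp [h6]

theorem abs_le_cosh_joukowskyLog (t : ℝ) : |t| ≤ Real.cosh (joukowskyLog (t : ℂ)) := by
  have h : (t : ℂ) - 1 + (t + 1) = ((2 * t : ℝ) : ℂ) := by push_cast; ring
  have := norm_add_le ((t : ℂ) - 1) (t + 1)
  rw [h, Complex.norm_real, Real.norm_eq_abs, abs_mul, abs_two] at this
  rw [cosh_joukowskyLog]
  linarith

theorem cosh_joukowskyLog_eq_abs {t : ℝ} (ht : joukowskyLog (t : ℂ) ≠ 0) :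
    Real.cosh (joukowskyLog (t : ℂ)) = |t| := by
  have h1 : ‖(t : ℂ) - 1‖ = |t - 1| := by
    rw [← Complex.ofReal_one, ← Complex.ofReal_sub, Complex.norm_real, Real.norm_eq_abs]
  have h2 : ‖(t : ℂ) + 1‖ = |t + 1| := by
    rw [← Complex.ofReal_one, ← Complex.ofReal_add, Complex.norm_real, Real.norm_eq_abs]
  have h3 : t ∉ Icc (-1 : ℝ) 1 := fun h => ht (joukowskyLog_ofReal h)
  rw [cosh_joukowskyLog, h1, h2]
  grind

theorem joukowskyLog_neg (w : ℂ) : joukowskyLog (-w) = joukowskyLog w := by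
  have h1 : ‖-w - 1‖ = ‖w + 1‖ := by rw [← norm_neg]; ring_nf
  have h2 : ‖-w + 1‖ = ‖w - 1‖ := by rw [← norm_neg]; ring_nf
  rw [joukowskyLog, joukowskyLog, h1, h2, add_comm]

theorem log_norm_le_joukowskyLog {w : ℂ} (hw : w ≠ 0) : Real.log ‖w‖ ≤ joukowskyLog w := by
  have hpos : 0 < ‖w‖ := norm_pos_iff.2 hw
  rw [Real.log_le_iff_le_exp hpos]
  have h := norm_add_le (w - 1) (w + 1)
  rw [show w - 1 + (w + 1) = 2 * w by ring, norm_mul, Complex.norm_ofNat] at h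
  have h2 := Real.exp_sub_cosh (joukowskyLog w)
  have h3 := Real.sinh_nonneg_iff.2 (joukowskyLog_nonneg w)
  linarith [cosh_joukowskyLog w]

theorem joukowskyLog_le (w : ℂ) : joukowskyLog w ≤ Real.log (2 * (‖w‖ + 1)) := by
  rw [Real.le_log_iff_exp_le (by positivity)]
  have h1 := norm_sub_le w 1
  have h2 := norm_add_le w 1
  rw [norm_one] at h1 h2
  have h3 := cosh_joukowskyLog w
  rw [Real.cosh_eq] at h3
  linarith [Real.exp_pos (-joukowskyLog w)]

/-- Put φ = f + √(f - 1)√(f + 1) = (p + q)²/2, analytic and without zeros. The parallelogram law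
gives J∘f = |log|φ||, and the sign of log|φ| is locally constant where it is nonzero. -/
theorem harmonicAt_joukowskyLog_comp {f : ℂ → ℂ} {z : ℂ} (hf : AnalyticAt ℂ f z)
    (hz : joukowskyLog (f z) ≠ 0) : HarmonicAt (fun y => joukowskyLog (f y)) z := by
  -- J is even, so f may be replaced by -f to keep f - 1 and f + 1 off the cut of the principal
  -- square root.
  wlog hre : 0 < (f z).re ∨ (f z).im ≠ 0 generalizing f
  · push Not at hre
    have hz' : joukowskyLog ((fun y => -f y) z) ≠ 0 := by rwa [joukowskyLog_neg]
    have := this (f := fun y => -f y) hf.neg hz' (Or.inl ?_)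
    · simpa only [joukowskyLog_neg] using this
    · refine (neg_pos.2 (lt_of_le_of_ne hre.1 fun h0 => hz ?_))
      have : f z = ((0 : ℝ) : ℂ) := Complex.ext h0 hre.2
      rw [this]
      exact joukowskyLog_ofReal (by norm_num)
  set p : ℂ → ℂ := fun y => (f y - 1) ^ (1 / 2 : ℂ) with hp
  set q : ℂ → ℂ := fun y => (f y + 1) ^ (1 / 2 : ℂ) with hq
  have hsq : ∀ u : ℂ, (u ^ (1 / 2 : ℂ)) ^ 2 = u := fun u => by
    rw [one_div]; exact Complex.cpow_nat_inv_pow u two_ne_zero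
  have hpan : AnalyticAt ℂ p z := by
    refine (hf.sub analyticAt_const).cpow analyticAt_const ?_
    rw [Complex.mem_slitPlane_iff]
    by_cases him : (f z).im = 0
    · left
      have h : 0 < (f z).re := hre.resolve_right (not_not.2 him)
      by_contra hle
      refine hz ?_
      have : f z = ((f z).re : ℂ) := Complex.ext rfl (by simp [him])
      rw [this]
      refine joukowskyLog_ofReal ⟨by linarith, ?_⟩
      simpa using hle
    · right; simpa using him
  have hqan : AnalyticAt ℂ q z := by
    refine (hf.add analyticAt_const).cpow analyticAt_const ?_
    rw [Complex.mem_slitPlane_iff]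
    rcases hre with h | h
    · left; simp; linarith
    · right; simpa using h
  set φ : ℂ → ℂ := fun y => (p y + q y) ^ 2 / 2 with hφ
  have hφan : AnalyticAt ℂ φ z := by
    simp only [hφ]
    fun_prop (disch := simp)
  have hprod : ∀ y, φ y * ((p y - q y) ^ 2 / 2) = 1 := fun y => by
    have : φ y * ((p y - q y) ^ 2 / 2) = (p y ^ 2 - q y ^ 2) ^ 2 / 4 := by simp only [hφ]; ring
    rw [this, hsq, hsq]
    ring
  have hφ0 : ∀ y, φ y ≠ 0 := fun y h => by simpa [h] using hprod y
  have hcosh : ∀ y, Real.cosh (Real.log ‖φ y‖) = Real.cosh (joukowskyLog (f y)) := fun y => by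
    have hinv : ‖φ y‖⁻¹ = ‖(p y - q y) ^ 2 / 2‖ := by
      rw [← norm_inv, inv_eq_of_mul_eq_one_right (hprod y)]
    rw [Real.cosh_log (norm_pos_iff.2 (hφ0 y)), hinv, cosh_joukowskyLog]
    have hpar := parallelogram_law_with_norm ℝ (p y) (q y)
    have h1 : ‖f y - 1‖ = ‖p y‖ * ‖p y‖ := by rw [← norm_mul, ← sq, hsq]
    have h2 : ‖f y + 1‖ = ‖q y‖ * ‖q y‖ := by rw [← norm_mul, ← sq, hsq]
    rw [h1, h2]
    simp only [hφ, norm_div, norm_pow, Complex.norm_ofNat]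
    linarith
  have habs : ∀ y, joukowskyLog (f y) = |Real.log ‖φ y‖| := fun y => by
    rw [← Real.arcosh_cosh (abs_nonneg (Real.log ‖φ y‖)), Real.cosh_abs, hcosh y,
      Real.arcosh_cosh (joukowskyLog_nonneg _)]
  have hlog : HarmonicAt (fun y => Real.log ‖φ y‖) z := hφan.harmonicAt_log_norm (hφ0 z)
  have hne : Real.log ‖φ z‖ ≠ 0 := by rw [habs z] at hz; exact abs_ne_zero.1 hz
  have hcont : ContinuousAt (fun y => Real.log ‖φ y‖) z := hlog.1.continuousAt
  rcases lt_or_gt_of_ne hne with h | h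
  · refine (harmonicAt_congr_nhds ?_).2 hlog.neg
    filter_upwards [hcont.eventually_lt_const h] with y hy
    simp only [Pi.neg_apply, habs, abs_of_neg hy]
  · refine (harmonicAt_congr_nhds ?_).2 hlog
    filter_upwards [hcont.eventually_const_lt h] with y hy
    simp only [habs, abs_of_pos hy]

theorem le_of_forall_pos_le_add_mul {a b c : ℝ} (h : ∀ ε > 0, a ≤ b + ε * c) : a ≤ b := by
  have ht : Tendsto (fun ε : ℝ => b + ε * c) (𝓝[>] 0) (𝓝 (b + 0 * c)) :=
    (Continuous.tendsto (by fun_prop) 0).mono_left nhdsWithin_le_nhds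
  rw [zero_mul, add_zero] at ht
  exact ge_of_tendsto ht (eventually_mem_nhdsWithin.mono h)

/-! ### Growth at infinity. -/

theorem tendsto_log_norm_cobounded : Tendsto (fun z : ℂ => Real.log ‖z‖) (cobounded ℂ) atTop :=
  Real.tendsto_log_atTop.comp tendsto_norm_cobounded_atTop

theorem joukowskyLog_eval_le_log {P : Polynomial ℂ} {n : ℕ} (hP : P.degree ≤ n) :
    ∃ C, ∀ᶠ z in cobounded ℂ, joukowskyLog (P.eval z) ≤ n * Real.log ‖z‖ + C := by
  obtain ⟨c, hc, hb⟩ := (Polynomial.isBigO_cobounded_of_degree_le (P := P)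
    (Q := Polynomial.X ^ n) (by rwa [Polynomial.degree_X_pow])).exists_pos
  refine ⟨Real.log (2 * (c + 1)), ?_⟩
  filter_upwards [hb.bound, tendsto_norm_cobounded_atTop.eventually_ge_atTop 1] with z hz hz1
  simp only [Polynomial.eval_pow, Polynomial.eval_X, norm_pow] at hz
  have hpos : 0 < ‖z‖ ^ n := by positivity
  refine (joukowskyLog_le _).trans ?_
  rw [← Real.log_pow, ← Real.log_mul hpos.ne' (by positivity)]
  refine Real.log_le_log (by positivity) ?_
  have := one_le_pow₀ (n := n) hz1
  nlinarith

theorem log_le_joukowskyLog_eval {P : Polynomial ℂ} {n : ℕ} (hP : P.degree = n) :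
    ∃ C, ∀ᶠ z in cobounded ℂ, n * Real.log ‖z‖ ≤ joukowskyLog (P.eval z) + C := by
  obtain ⟨c, hc, hb⟩ := (Polynomial.isBigO_cobounded_of_degree_le (P := Polynomial.X ^ n)
    (Q := P) (by rw [Polynomial.degree_X_pow, hP])).exists_pos
  refine ⟨Real.log c, ?_⟩
  filter_upwards [hb.bound, tendsto_norm_cobounded_atTop.eventually_ge_atTop 1] with z hz hz1
  simp only [Polynomial.eval_pow, Polynomial.eval_X, norm_pow] at hz
  have hpos : 0 < ‖z‖ ^ n := by positivity
  have h0 : P.eval z ≠ 0 := by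
    intro h0
    rw [h0, norm_zero, mul_zero] at hz
    linarith
  have hlog := Real.log_le_log hpos hz
  rw [Real.log_pow, Real.log_mul hc.ne' (norm_ne_zero_iff.2 h0)] at hlog
  linarith [log_norm_le_joukowskyLog h0]

theorem inversePolyImage_eq (P : Polynomial ℂ) :
    inversePolyImage P = {z | joukowskyLog (P.eval z) = 0} := by
  ext z
  refine ⟨?_, exists_ofReal_of_joukowskyLog_eq_zero⟩
  rintro ⟨t, ht, h⟩
  rw [mem_ofPred_eq, h, joukowskyLog_ofReal ht]

theorem continuous_joukowskyLog_eval (P : Polynomial ℂ) :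
    Continuous fun z => joukowskyLog (P.eval z) :=
  continuous_joukowskyLog.comp P.continuous

theorem harmonicAt_joukowskyLog_eval {P : Polynomial ℂ} {z : ℂ}
    (hz : joukowskyLog (P.eval z) ≠ 0) : HarmonicAt (fun z => joukowskyLog (P.eval z)) z :=
  harmonicAt_joukowskyLog_comp
    (P.differentiable.differentiableOn.analyticAt (s := univ) univ_mem) hz

/-! ### Comparison of n g with J∘P. -/

namespace IsGreenFunction

variable {K : Set ℂ} {g : ℂ → ℝ}

theorem eventually_abs_sub_log_le (hg : IsGreenFunction K g) :
    ∃ C, ∀ᶠ z in cobounded ℂ, |g z - Real.log ‖z‖| ≤ C := by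
  obtain ⟨h, hh, hgh⟩ := hg.harmonic_at_infinity
  have ht : Tendsto (fun z : ℂ => |h z⁻¹|) (cobounded ℂ) (𝓝 |h 0|) :=
    (hh.1.continuousAt.tendsto.comp tendsto_inv₀_cobounded).abs
  refine ⟨|h 0| + 1, ?_⟩
  filter_upwards [hgh, ht.eventually_lt_const (lt_add_one _)] with z hz hz'
  rw [hz]
  exact hz'.le

theorem tendsto_cobounded (hg : IsGreenFunction K g) : Tendsto g (cobounded ℂ) atTop := by
  obtain ⟨C, hC⟩ := hg.eventually_abs_sub_log_le
  refine tendsto_atTop_mono' _ ?_ (tendsto_atTop_add_const_right _ (-C) tendsto_log_norm_cobounded)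
  filter_upwards [hC] with z hz
  linarith [(abs_le.1 hz).1]

theorem nonneg (hg : IsGreenFunction K g) (hK : IsClosed K) {z : ℂ} (hz : z ∉ K) : 0 ≤ g z :=
  nonneg_of_harmonicOnNhd_compl hK hg.harmonic
    (fun ζ hζ _ hc => (hg.tendsto_zero ζ hζ).eventually_const_lt hc) hg.tendsto_cobounded hz

theorem pos (hg : IsGreenFunction K g) (hK : IsCompact K) (hconn : IsPreconnected Kᶜ) {z : ℂ}
    (hz : z ∉ K) : 0 < g z := by
  refine lt_of_le_of_ne (hg.nonneg hK.isClosed hz) fun h0 => ?_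
  obtain ⟨y, hy, hyK⟩ := ((hg.tendsto_cobounded.eventually_gt_atTop 0).and
    (isBounded_def.1 hK.isBounded)).exists
  exact hy.ne' (eq_zero_of_nonneg_of_harmonicAt_zeros hK.isClosed.isOpen_compl hconn
    hg.harmonic.continuousOn (fun _ => hg.nonneg hK.isClosed) (fun u hu _ => hg.harmonic u hu) hz
    h0.symm hyK)

/-- The Bernstein–Walsh inequality, in terms of the Joukowsky parameter. -/
theorem joukowskyLog_eval_le (hg : IsGreenFunction K g) (hK : IsClosed K) {P : Polynomial ℂ}
    {n : ℕ} (hP : P.degree ≤ n) (hPK : ∀ ζ ∈ K, joukowskyLog (P.eval ζ) = 0) {z : ℂ}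
    (hz : z ∉ K) : joukowskyLog (P.eval z) ≤ n * g z := by
  by_cases hz0 : joukowskyLog (P.eval z) = 0
  · rw [hz0]
    exact mul_nonneg n.cast_nonneg (hg.nonneg hK hz)
  -- The surplus ε g forces the difference to +∞ at infinity. The minimum principle is applied off
  -- the zero set of J∘P, which contains K, since J∘P need not be harmonic at its zeros.
  refine le_of_forall_pos_le_add_mul (c := g z) fun ε hε => ?_
  set S : Set ℂ := {z | joukowskyLog (P.eval z) = 0} with hS
  have hcont := continuous_joukowskyLog_eval P
  have hSK : Sᶜ ⊆ Kᶜ := compl_subset_compl.2 hPK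
  have key := nonneg_of_harmonicOnNhd_compl (S := S)
    (v := (n + ε) • g - fun z => joukowskyLog (P.eval z)) (isClosed_eq hcont continuous_const)
    (fun y hy => (HarmonicAt.const_smul (hg.harmonic y (hSK hy))).sub
      (harmonicAt_joukowskyLog_eval hy)) ?_ ?_ (z := z) hz0
  · simp only [Pi.sub_apply, Pi.smul_apply, smul_eq_mul] at key
    linarith
  · intro ζ hζ c hc
    have hPζ : Tendsto (fun z => joukowskyLog (P.eval z)) (𝓝[Sᶜ] ζ) (𝓝 0) := by
      have := (hcont.tendsto ζ).mono_left (nhdsWithin_le_nhds (s := Sᶜ))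
      rwa [show joukowskyLog (P.eval ζ) = 0 from hζ] at this
    obtain ⟨m, hm, hgm⟩ : ∃ m, 0 ≤ m ∧ Tendsto g (𝓝[Sᶜ] ζ) (𝓝 m) := by
      by_cases hζK : ζ ∈ K
      · exact ⟨0, le_rfl, (hg.tendsto_zero ζ hζK).mono_left (nhdsWithin_mono ζ hSK)⟩
      · exact ⟨g ζ, hg.nonneg hK hζK,
          (hg.harmonic ζ hζK).1.continuousAt.tendsto.mono_left nhdsWithin_le_nhds⟩
    refine ((hgm.const_smul (n + ε)).sub hPζ).eventually_const_lt ?_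
    simp only [smul_eq_mul, sub_zero]
    exact hc.trans_le (by positivity)
  · obtain ⟨C₁, h₁⟩ := hg.eventually_abs_sub_log_le
    obtain ⟨C₂, h₂⟩ := joukowskyLog_eval_le_log hP
    refine tendsto_atTop_mono' _ ?_ (tendsto_atTop_add_const_right _ (-((n + ε) * C₁ + C₂))
      (tendsto_log_norm_cobounded.const_mul_atTop hε))
    filter_upwards [h₁, h₂] with y hy₁ hy₂
    have : (n + ε) * (Real.log ‖y‖ - C₁) ≤ (n + ε) * g y :=
      mul_le_mul_of_nonneg_left (by linarith [(abs_le.1 hy₁).1]) (by positivity)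
    simp only [Pi.sub_apply, Pi.smul_apply, smul_eq_mul]
    linarith

/-- Here J∘P is harmonic on all of the complement of K, because its zero set is exactly K; the exact
degree supplies the lower growth bound. -/
theorem le_joukowskyLog_eval (hg : IsGreenFunction K g) {P : Polynomial ℂ} {n : ℕ}
    (hn : 1 ≤ n) (hP : P.degree = n) (hPK : inversePolyImage P = K) {z : ℂ}
    (hz : z ∉ K) : n * g z ≤ joukowskyLog (P.eval z) := by
  refine le_of_forall_pos_le_add_mul (c := joukowskyLog (P.eval z)) fun ε hε => ?_
  rw [inversePolyImage_eq] at hPK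
  have hcont := continuous_joukowskyLog_eval P
  have key := nonneg_of_harmonicOnNhd_compl (S := K)
    (v := (1 + ε) • (fun z => joukowskyLog (P.eval z)) - (n : ℝ) • g)
    (hPK ▸ isClosed_eq hcont continuous_const)
    (fun y hy => (HarmonicAt.const_smul
      (harmonicAt_joukowskyLog_eval fun h => hy (hPK ▸ h))).sub
      (HarmonicAt.const_smul (hg.harmonic y hy))) ?_ ?_ (z := z) hz
  · simp only [Pi.sub_apply, Pi.smul_apply, smul_eq_mul] at key
    linarith
  · intro ζ hζ c hc
    have hPζ : Tendsto (fun z => joukowskyLog (P.eval z)) (𝓝[Kᶜ] ζ) (𝓝 0) := by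
      have := (hcont.tendsto ζ).mono_left (nhdsWithin_le_nhds (s := Kᶜ))
      rw [← hPK] at hζ
      rwa [show joukowskyLog (P.eval ζ) = 0 from hζ] at this
    refine ((hPζ.const_smul (1 + ε)).sub
      ((hg.tendsto_zero ζ hζ).const_smul (n : ℝ))).eventually_const_lt ?_
    simpa using hc
  · obtain ⟨C₁, h₁⟩ := hg.eventually_abs_sub_log_le
    obtain ⟨C₂, h₂⟩ := log_le_joukowskyLog_eval hP
    have hn' : (0 : ℝ) < n := by exact_mod_cast hn
    refine tendsto_atTop_mono' _ ?_ (tendsto_atTop_add_const_right _ (-((1 + ε) * C₂ + n * C₁))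
      (tendsto_log_norm_cobounded.const_mul_atTop (mul_pos hε hn')))
    filter_upwards [h₁, h₂] with y hy₁ hy₂
    have e₁ : (1 + ε) * (n * Real.log ‖y‖ - C₂) ≤ (1 + ε) * joukowskyLog (P.eval y) :=
      mul_le_mul_of_nonneg_left (by linarith) (by positivity)
    have e₂ : n * g y ≤ n * (Real.log ‖y‖ + C₁) :=
      mul_le_mul_of_nonneg_left (by linarith [(abs_le.1 hy₁).2]) hn'.le
    simp only [Pi.sub_apply, Pi.smul_apply, smul_eq_mul]
    linarith

end IsGreenFunction

/-! ### Connectedness of the complement, and real parts of polynomials. -/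

theorem isPreconnected_compl_ofReal_image {A : Set ℝ} {x : ℝ} (hx : x ∉ A) :
    IsPreconnected (Complex.ofReal '' A)ᶜ := by
  have hmem : ∀ z ∈ (Complex.ofReal '' A)ᶜ, z.im = 0 → z.re ∉ A := fun z hz him hA =>
    hz ⟨z.re, hA, Complex.ext rfl (by simp [him])⟩
  -- This set lies between the open half-plane and its closure. The upper and lower pieces meet at
  -- x.
  have hup : IsPreconnected ({z : ℂ | 0 ≤ z.im} ∩ (Complex.ofReal '' A)ᶜ) := by
    refine (convex_halfSpace_im_gt 0).isPreconnected.subset_closure ?_ ?_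
    · intro z hz
      refine ⟨show 0 ≤ z.im from le_of_lt hz, ?_⟩
      rintro ⟨t, -, rfl⟩
      simp at hz
    · rw [Complex.closure_setOfPred_lt_im]
      exact inter_subset_left
  have hlow : IsPreconnected ({z : ℂ | z.im ≤ 0} ∩ (Complex.ofReal '' A)ᶜ) := by
    refine (convex_halfSpace_im_lt 0).isPreconnected.subset_closure ?_ ?_
    · intro z hz
      refine ⟨show z.im ≤ 0 from le_of_lt hz, ?_⟩
      rintro ⟨t, -, rfl⟩
      simp at hz
    · rw [Complex.closure_setOfPred_im_lt]
      exact inter_subset_left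
  have hxA : (x : ℂ) ∈ (Complex.ofReal '' A)ᶜ := by simpa using hx
  have := IsPreconnected.union (x : ℂ)
    (mem_inter (show (0 : ℝ) ≤ (x : ℂ).im by simp) hxA)
    (mem_inter (show (x : ℂ).im ≤ 0 by simp) hxA) hup hlow
  convert this using 1
  rw [← union_inter_distrib_right]
  refine (inter_eq_right.2 fun z _ => ?_).symm
  exact le_total 0 z.im

namespace Polynomial

theorem degree_C_mul_le (c : ℂ) (P : Polynomial ℂ) : (C c * P).degree ≤ P.degree := by
  rw [← smul_eq_C_mul]
  exact degree_smul_le c P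

/-- The polynomial with real coefficients that agrees on the real line with the real part of `P`. -/
noncomputable def realPart (P : Polynomial ℂ) : Polynomial ℂ :=
  C (1 / 2) * (P + P.map (starRingEnd ℂ))

theorem eval_realPart (P : Polynomial ℂ) (y : ℝ) :
    (realPart P).eval (y : ℂ) = ((P.eval (y : ℂ)).re : ℂ) := by
  have h : (P.map (starRingEnd ℂ)).eval (y : ℂ) = starRingEnd ℂ (P.eval (y : ℂ)) := by
    rw [eval_map]
    nth_rewrite 1 [← Complex.conj_ofReal y]
    exact eval₂_at_apply _ _
  rw [realPart, eval_mul, eval_C, eval_add, h, Complex.add_conj]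
  push_cast
  ring

theorem degree_realPart_le {P : Polynomial ℂ} {n : ℕ} (hP : P.degree ≤ n) :
    (realPart P).degree ≤ n := by
  refine (degree_C_mul_le _ _).trans ((degree_add_le _ _).trans (max_le hP ?_))
  exact (degree_map_le (p := P)).trans hP

theorem eq_realPart_of_im_eval_eq_zero {P : Polynomial ℂ} {B : Set ℝ} (hB : B.Infinite)
    (h : ∀ y ∈ B, (P.eval (y : ℂ)).im = 0) : realPart P = P := by
  refine eq_of_infinite_eval_eq _ _ ((hB.image Complex.ofReal_injective.injOn).mono ?_)
  rintro _ ⟨y, hy, rfl⟩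
  change eval (y : ℂ) (realPart P) = eval (y : ℂ) P
  rw [eval_realPart]
  exact Complex.ext rfl (by simp [h y hy])

end Polynomial

/-! ### The bound at real points and its equality case. -/

open Polynomial

namespace IsGreenFunction

variable {A : Set ℝ} {g : ℂ → ℝ} {P : Polynomial ℂ} {n : ℕ}

theorem joukowskyLog_eval_realPart_eq_zero (hPA : ∀ y ∈ A, ‖P.eval (y : ℂ)‖ ≤ 1) :
    ∀ ζ ∈ Complex.ofReal '' A, joukowskyLog ((realPart P).eval ζ) = 0 := by
  rintro _ ⟨y, hy, rfl⟩
  rw [eval_realPart]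
  exact joukowskyLog_ofReal (abs_le.1 ((Complex.abs_re_le_norm _).trans (hPA y hy)))

theorem norm_eval_le_cosh (hg : IsGreenFunction (Complex.ofReal '' A) g) (hA : IsCompact A)
    (hP : P.degree ≤ n) (hPA : ∀ y ∈ A, ‖P.eval (y : ℂ)‖ ≤ 1) {x : ℝ} (hx : x ∉ A) :
    ‖P.eval (x : ℂ)‖ ≤ Real.cosh (n * g x) := by
  have hK : IsCompact (Complex.ofReal '' A) := hA.image Complex.continuous_ofReal
  obtain ⟨u, hu, hux⟩ := RCLike.exists_norm_eq_mul_self (P.eval (x : ℂ))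
  have hxK : (x : ℂ) ∉ Complex.ofReal '' A := by simpa using hx
  have hle := hg.joukowskyLog_eval_le hK.isClosed (P := realPart (C u * P))
    (degree_realPart_le ((degree_C_mul_le _ _).trans hP))
    (joukowskyLog_eval_realPart_eq_zero fun y hy => by simpa [hu] using hPA y hy) hxK
  have hval : ((C u * P).eval (x : ℂ)).re = ‖P.eval (x : ℂ)‖ := by
    rw [eval_C_mul, ← hux]
    rfl
  rw [eval_realPart, hval] at hle
  calc ‖P.eval (x : ℂ)‖ = |‖P.eval (x : ℂ)‖| := (abs_norm _).symm
    _ ≤ _ := abs_le_cosh_joukowskyLog _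
    _ ≤ _ := Real.cosh_le_cosh.2 (abs_le_abs_of_nonneg (joukowskyLog_nonneg _) hle)

/-- If a polynomial `P` bounded by `1` on a compact set of real numbers attains the bound
`cosh (n g)` at one real point outside, then a rotation of `P` has that set as inverse image of `[-1, 1]`. -/
theorem exists_inversePolyImage_eq (hg : IsGreenFunction (Complex.ofReal '' A) g)
    (hA : IsCompact A) (hn : 1 ≤ n) (hP : P.degree ≤ n)
    (hPA : ∀ y ∈ A, ‖P.eval (y : ℂ)‖ ≤ 1) {x : ℝ} (hx : x ∉ A)
    (heq : ‖P.eval (x : ℂ)‖ = Real.cosh (n * g x)) :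
    ∃ u : ℂ, u ≠ 0 ∧ inversePolyImage (C u * P) = Complex.ofReal '' A := by
  have hK : IsCompact (Complex.ofReal '' A) := hA.image Complex.continuous_ofReal
  obtain ⟨u, hu, hux⟩ := RCLike.exists_norm_eq_mul_self (P.eval (x : ℂ))
  have hcompl : ∀ y ∉ A, (y : ℂ) ∉ Complex.ofReal '' A := fun y hy => by simpa using hy
  have hconn := isPreconnected_compl_ofReal_image hx
  have hn' : (0 : ℝ) < n := by exact_mod_cast hn
  have hdeg : (C u * P).degree ≤ n := (degree_C_mul_le _ _).trans hP
  have hbound : ∀ y ∈ A, ‖(C u * P).eval (y : ℂ)‖ ≤ 1 := fun y hy => by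
    simpa [hu] using hPA y hy
  set R := realPart (C u * P) with hR
  have hRK := joukowskyLog_eval_realPart_eq_zero hbound
  have hle : ∀ z ∉ Complex.ofReal '' A, joukowskyLog (R.eval z) ≤ n * g z := fun z hz =>
    hg.joukowskyLog_eval_le hK.isClosed (degree_realPart_le hdeg) hRK hz
  have hpos : ∀ z ∉ Complex.ofReal '' A, 0 < n * g z := fun z hz =>
    mul_pos hn' (hg.pos hK hconn hz)
  have hxeq : joukowskyLog (R.eval (x : ℂ)) = n * g x := by
    refine le_antisymm (hle _ (hcompl x hx)) ?_
    have h := abs_le_cosh_joukowskyLog ‖P.eval (x : ℂ)‖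
    have hval : R.eval (x : ℂ) = (‖P.eval (x : ℂ)‖ : ℂ) := by
      rw [hR, eval_realPart, eval_C_mul, ← hux]
      rfl
    rw [← hval, abs_norm, heq, Real.cosh_le_cosh, abs_of_pos (hpos _ (hcompl x hx)),
      abs_of_nonneg (joukowskyLog_nonneg _)] at h
    exact h
  have hall : ∀ z ∉ Complex.ofReal '' A, joukowskyLog (R.eval z) = n * g z := by
    intro z hz
    have := eq_zero_of_nonneg_of_harmonicAt_zeros (U := (Complex.ofReal '' A)ᶜ)
      (v := (n : ℝ) • g - fun z => joukowskyLog (R.eval z)) hK.isClosed.isOpen_compl hconn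
      ((hg.harmonic.continuousOn.const_smul (n : ℝ)).sub
        (continuous_joukowskyLog_eval R).continuousOn)
      (fun y hy => by simpa using hle y hy)
      (fun y hy hy0 => (HarmonicAt.const_smul (hg.harmonic y hy)).sub
        (harmonicAt_joukowskyLog_eval ?_))
      (hcompl x hx) (by simp [hxeq]) hz
    · simp only [Pi.sub_apply, Pi.smul_apply, smul_eq_mul] at this
      linarith
    · have := hpos y hy
      simp only [Pi.sub_apply, Pi.smul_apply, smul_eq_mul] at hy0
      linarith
  -- At real y off A, |Re uP(y)| = cosh(n g(y)) ≥ |uP(y)|, so uP is real at infinitely many points.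
  have hRP : R = C u * P := by
    have hBinf : (Aᶜ : Set ℝ).Infinite :=
      infinite_of_mem_nhds x (hA.isClosed.isOpen_compl.mem_nhds hx)
    refine eq_realPart_of_im_eval_eq_zero hBinf fun y hy => ?_
    rw [← Complex.abs_re_eq_norm]
    refine le_antisymm (Complex.abs_re_le_norm _) ?_
    have hy' := hcompl y hy
    have hJ := hall _ hy'
    have hJpos := hpos _ hy'
    rw [← hJ, hR, eval_realPart] at hJpos
    rw [← cosh_joukowskyLog_eq_abs hJpos.ne', ← eval_realPart, hJ]
    exact hg.norm_eval_le_cosh hA hdeg hbound hy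
  refine ⟨u, norm_ne_zero_iff.1 (by rw [hu]; exact one_ne_zero), ?_⟩
  rw [← hRP, inversePolyImage_eq]
  refine Subset.antisymm (fun z hz => ?_) hRK
  by_contra hzK
  exact (hpos z hzK).ne' ((hall z hzK).symm.trans hz)

/-- P is real on the infinite set A, hence on the whole real line; so P(x) is real, and J(P(x)) = n
g(x) ≠ 0 determines |P(x)|. -/
theorem norm_eval_eq_cosh (hg : IsGreenFunction (Complex.ofReal '' A) g) (hAinf : A.Infinite)
    (hA : IsCompact A) (hn : 1 ≤ n) (hP : P.degree = n)
    (hPA : inversePolyImage P = Complex.ofReal '' A) {x : ℝ} (hx : x ∉ A) :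
    ‖P.eval (x : ℂ)‖ = Real.cosh (n * g x) := by
  have hK : IsCompact (Complex.ofReal '' A) := hA.image Complex.continuous_ofReal
  have hxK : (x : ℂ) ∉ Complex.ofReal '' A := by simpa using hx
  have hval : ∀ y ∈ A, ∃ t ∈ Icc (-1 : ℝ) 1, P.eval (y : ℂ) = t := fun y hy => by
    have : (y : ℂ) ∈ inversePolyImage P := hPA ▸ mem_image_of_mem _ hy
    exact this
  have hreal : realPart P = P := eq_realPart_of_im_eval_eq_zero hAinf fun y hy => by
    obtain ⟨t, -, ht⟩ := hval y hy
    simp [ht]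
  have hxre : P.eval (x : ℂ) = ((P.eval (x : ℂ)).re : ℂ) := by
    rw [← eval_realPart, hreal]
  have hJ : joukowskyLog (P.eval (x : ℂ)) = n * g x := by
    refine le_antisymm (hg.joukowskyLog_eval_le hK.isClosed hP.le (fun ζ hζ => ?_) hxK)
      (hg.le_joukowskyLog_eval hn hP hPA hxK)
    rw [← hPA, inversePolyImage_eq] at hζ
    exact hζ
  have hJ0 : joukowskyLog (P.eval (x : ℂ)) ≠ 0 := fun h => hxK (by
    rw [← hPA, inversePolyImage_eq]
    exact h)
  rw [hxre] at hJ hJ0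
  rw [hxre, Complex.norm_real, Real.norm_eq_abs, ← cosh_joukowskyLog_eq_abs hJ0, hJ]

end IsGreenFunction

/-! ### Supremum norms and unions of intervals. -/

theorem polySupNorm_C_mul (S : Set ℂ) (c : ℂ) (Q : Polynomial ℂ) :
    polySupNorm S (C c * Q) = ‖c‖ * polySupNorm S Q := by
  simp only [polySupNorm, eval_C_mul, norm_mul]
  rw [← smul_eq_mul ‖c‖, ← Real.sSup_smul_of_nonneg (norm_nonneg c), ← image_smul, image_image]
  simp only [smul_eq_mul]

theorem norm_eval_le_polySupNorm {S : Set ℂ} (hS : IsCompact S) (Q : Polynomial ℂ) {z : ℂ}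
    (hz : z ∈ S) : ‖Q.eval z‖ ≤ polySupNorm S Q :=
  le_csSup (hS.image Q.continuous.norm).bddAbove (mem_image_of_mem _ hz)

theorem polySupNorm_pos {S : Set ℂ} (hS : IsCompact S) (hinf : S.Infinite) {Q : Polynomial ℂ}
    (hQ : Q ≠ 0) : 0 < polySupNorm S Q := by
  obtain ⟨z, hz, hzQ⟩ : ∃ z ∈ S, Q.eval z ≠ 0 := by
    by_contra! h
    exact hQ (eq_zero_of_infinite_isRoot Q (hinf.mono h))
  exact (norm_pos_iff.2 hzQ).trans_le (norm_eval_le_polySupNorm hS Q hz)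

theorem polySupNorm_inversePolyImage {P : Polynomial ℂ} (hP : 0 < P.degree) :
    polySupNorm (inversePolyImage P) P = 1 := by
  -- The value 1 is attained, by the fundamental theorem of algebra.
  obtain ⟨z, hz⟩ := Complex.exists_root (f := P - C 1) (by rwa [degree_sub_C hP])
  have hz1 : P.eval z = 1 := by simpa [sub_eq_zero] using hz
  refine IsGreatest.csSup_eq ⟨⟨z, ⟨1, by norm_num, by simp [hz1]⟩, by simp [hz1]⟩, ?_⟩
  rintro _ ⟨w, ⟨t, ht, hw⟩, rfl⟩
  simp only [hw, Complex.norm_real, Real.norm_eq_abs]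
  exact abs_le.2 ht

theorem isCompact_intervalUnion {ℓ : ℕ} (a : Fin (2 * ℓ) → ℝ) : IsCompact (intervalUnion a) :=
  isCompact_iUnion fun _ => isCompact_Icc

theorem infinite_intervalUnion {ℓ : ℕ} (hℓ : 1 ≤ ℓ) {a : Fin (2 * ℓ) → ℝ} (ha : StrictMono a) :
    (intervalUnion a).Infinite :=
  (Icc_infinite (ha (by simp [Fin.lt_def]))).mono (subset_iUnion_of_subset ⟨0, hℓ⟩ subset_rfl)

end

theorem corollary3 (ℓ : ℕ) (hℓ : 1 ≤ ℓ) (a : Fin (2 * ℓ) → ℝ) (ha : StrictMono a)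
    (K : Set ℂ) (hK : K = Complex.ofReal '' intervalUnion a)
    (g : ℂ → ℝ) (hg : IsGreenFunction K g)
    (n : ℕ) (Q : Polynomial ℂ) (hQ : Q.degree = (n : WithBot ℕ))
    (x : ℝ) (hx : (x : ℂ) ∉ K) :
    ‖Q.eval (x : ℂ)‖ / polySupNorm K Q ≤
        1 / 2 * (Real.exp (n * g x) + Real.exp (-(n * g x))) ∧
      (1 ≤ n →
        (‖Q.eval (x : ℂ)‖ / polySupNorm K Q =
            1 / 2 * (Real.exp (n * g x) + Real.exp (-(n * g x))) ↔
          ∃ c : ℂ, c ≠ 0 ∧ inversePolyImage (Polynomial.C c * Q) = K)) := by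
  subst hK
  have hA := isCompact_intervalUnion a
  have hAinf := infinite_intervalUnion hℓ ha
  have hKc := hA.image Complex.continuous_ofReal
  have hxA : x ∉ intervalUnion a := by simpa using hx
  have hQ0 : Q ≠ 0 := fun h => by simp [h] at hQ
  have hM := polySupNorm_pos hKc (hAinf.image Complex.ofReal_injective.injOn) hQ0
  set M := polySupNorm (Complex.ofReal '' intervalUnion a) Q with hMdef
  have hM0 : (M⁻¹ : ℂ) ≠ 0 := by exact_mod_cast (inv_pos.2 hM).ne'
  have hnorm : ‖(M⁻¹ : ℂ)‖ = M⁻¹ := by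
    rw [norm_inv, Complex.norm_real, Real.norm_eq_abs, abs_of_pos hM]
  have hval : ∀ z : ℂ, ‖(Polynomial.C (M⁻¹ : ℂ) * Q).eval z‖ = ‖Q.eval z‖ / M := fun z => by
    rw [Polynomial.eval_C_mul, norm_mul, hnorm, div_eq_inv_mul]
  have hdeg : ∀ c : ℂ, c ≠ 0 → (Polynomial.C c * Q).degree = n := fun c hc => by
    rw [Polynomial.degree_C_mul hc, hQ]
  have hbound : ∀ y ∈ intervalUnion a, ‖(Polynomial.C (M⁻¹ : ℂ) * Q).eval (y : ℂ)‖ ≤ 1 :=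
      fun y hy => by
    rw [hval, div_le_one hM]
    exact norm_eval_le_polySupNorm hKc Q (Set.mem_image_of_mem _ hy)
  have hcosh : 1 / 2 * (Real.exp (n * g x) + Real.exp (-(n * g x))) = Real.cosh (n * g x) := by
    rw [Real.cosh_eq]
    ring
  rw [hcosh, ← hval]
  refine ⟨hg.norm_eval_le_cosh hA (hdeg _ hM0).le hbound hxA, fun hn => ⟨fun heq => ?_, ?_⟩⟩
  · obtain ⟨u, hu, huK⟩ := hg.exists_inversePolyImage_eq hA hn (hdeg _ hM0).le hbound hxA heq
    exact ⟨u * (M : ℂ)⁻¹, mul_ne_zero hu hM0, by rw [Polynomial.C_mul, mul_assoc, huK]⟩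
  · rintro ⟨c, hc, hcK⟩
    -- The norm of cQ on K is 1, which forces |c| = 1/M.
    have h1 := polySupNorm_inversePolyImage (P := Polynomial.C c * Q)
      (by rw [hdeg c hc]; exact_mod_cast hn)
    rw [hcK, polySupNorm_C_mul] at h1
    have hcM : ‖c‖ = M⁻¹ := eq_inv_of_mul_eq_one_left h1
    rw [← hg.norm_eval_eq_cosh hAinf hA hn (hdeg c hc) hcK hxA, hval,
      Polynomial.eval_C_mul, norm_mul, hcM, div_eq_inv_mul]
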